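/- Let $n\ge 1$, $t_0\in\mathbb R$, and let $P,Q,R,S$ be complex $n\times n$ matrix functions that are locally integrable on $[t_0,\infty)$. Consider the matrix Riccati equation $$Z'+ZP(t)Z+Q(t)Z+ZR(t)+S(t)=0,\qquad t\ge t_0. \tag{1}$$ "Absolutely continuous on an interval" means absolutely continuous on each of its compact subintervals; a solution of (1) on an interval is a matrix function that is absolutely continuous there and satisfies (1) almost everywhere there. For Hermitian matrices, $H_1\ge H_2$ ($H_1>H_2$) means that $H_1-H_2$ is positive semidefinite (positive definite); $^*$ is the conjugate transpose. Let $U$ and $\Lambda$ be absolutely continuous complex $n\times n$ matrix functions on $[t_0,\infty)$ with $\det U(t)\ne0$ for all $t\ge t_0$, let $\mu$ be a real-valued locally integrable function on $[t_0,\infty)$, and put $$S_{U,\Lambda}=\Lambda'+\Lambda PU\Lambda+\bigl[U^{-1}U'+U^{-1}QU\bigr]\Lambda+\Lambda R+U^{-1}S .$$ Assume that for almost every $t\ge t_0$: (I) $P(t)U(t)$ is Hermitian and $P(t)U(t)\ge0$; (II) $R(t)=(U^{-1}(t)Q(t)U(t))^*+P(t)U(t)\,[\Lambda^*(t)-\Lambda(t)]+(U^{-1}(t)U'(t))^*+\mu(t)I$;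 (III) $S_{U,\Lambda}(t)+S_{U,\Lambda}^*(t)\le0$. Then for every matrix $Z_0$ with $U^{-1}(t_0)Z_0+Z_0^*(U^*)^{-1}(t_0)>\Lambda(t_0)+\Lambda^*(t_0)$ there is a solution $Z$ of (1) on $[t_0,\infty)$ with $Z(t_0)=Z_0$; every solution of (1) with value $Z_0$ at $t_0$, on any interval $I\subseteq[t_0,\infty)$ containing $t_0$, coincides with $Z$ on $I$; and $$U^{-1}(t)Z(t)+Z^*(t)(U^*)^{-1}(t)>\Lambda(t)+\Lambda^*(t)\qquad\text{for all } t\ge t_0.$$ (That is, every solution satisfying the strict inequality at $t_0$ exists on $[t_0,\infty)$ and keeps it.) If moreover $U^{-1}(t_0)+(U^{-1}(t_0))^*>0$, then the same holds with $\ge$ in place of $>$, both in the condition on $Z_0$ and in the conclusion. -/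

import Mathlib

open MeasureTheory Set
open scoped Matrix ComplexOrder

noncomputable section

/-- The entrywise derivative of a matrix function of a real variable. -/
def matrixDeriv {n : ℕ} (F : ℝ → Matrix (Fin n) (Fin n) ℂ) (t : ℝ) :
    Matrix (Fin n) (Fin n) ℂ :=
  Matrix.of fun i j => deriv (fun s => F s i j) t

/-- Every entry of the matrix function is (measurable and) locally integrable on `I`. -/
def MatrixLocallyIntegrableOn {n : ℕ} (F : ℝ → Matrix (Fin n) (Fin n) ℂ) (I : Set ℝ) : Prop :=
  ∀ i j, LocallyIntegrableOn (fun t => F t i j) I volume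

/-- Every entry of the matrix function is absolutely continuous on each compact subinterval of
the interval `I`: absolute continuity in the sense of the theory of differential equations with
locally integrable coefficients. -/
def MatrixAbsolutelyContinuousOn {n : ℕ} (F : ℝ → Matrix (Fin n) (Fin n) ℂ) (I : Set ℝ) :
    Prop :=
  ∀ a ∈ I, ∀ b ∈ I, a ≤ b → ∀ i j, AbsolutelyContinuousOnInterval (fun t => F t i j) a b

/-- `Z` is a solution on the interval `I` of the matrix Riccati equation
`Z' + Z P Z + Q Z + Z R + S = 0`: it is absolutely continuous (on compact subintervals) and
satisfies the equation almost everywhere on `I`. -/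
def IsRiccatiSolutionOn {n : ℕ} (P Q R S : ℝ → Matrix (Fin n) (Fin n) ℂ) (I : Set ℝ)
    (Z : ℝ → Matrix (Fin n) (Fin n) ℂ) : Prop :=
  MatrixAbsolutelyContinuousOn Z I ∧
    ∀ᵐ t, t ∈ I →
      matrixDeriv Z t + Z t * P t * Z t + Q t * Z t + Z t * R t + S t = 0

/-- The matrix function
`S_{U,Λ} = Λ' + Λ P U Λ + (U⁻¹ U' + U⁻¹ Q U) Λ + Λ R + U⁻¹ S`. -/
def riccatiS {n : ℕ} (P Q R S U L : ℝ → Matrix (Fin n) (Fin n) ℂ) (t : ℝ) :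
    Matrix (Fin n) (Fin n) ℂ :=
  matrixDeriv L t + L t * P t * U t * L t
    + ((U t)⁻¹ * matrixDeriv U t + (U t)⁻¹ * Q t * U t) * L t
    + L t * R t + (U t)⁻¹ * S t

/-- The difference `U⁻¹ Z + Z* (U*)⁻¹ - (Λ + Λ*)` of constant matrices. -/
def riccatiGap {n : ℕ} (U L Z : Matrix (Fin n) (Fin n) ℂ) : Matrix (Fin n) (Fin n) ℂ :=
  (U⁻¹ * Z + Zᴴ * (Uᴴ)⁻¹) - (L + Lᴴ)

end

/-!
With `A = P U`, `Z = U Y` and `W = Y - Λ`, the Riccati equation becomes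
`W' + W A W + C W + W C* + μ W + T = 0`, where `T = S_{U,Λ}` and `C = U⁻¹ U' + U⁻¹ Q U + Λ A`; the
prescribed form of `R` is what makes the two linear terms adjoint to each other. The gap whose
positivity is claimed is `W + W*`.

Instead of bounding `W`, the proof linearizes. The system `X' = -(Q X + S V)`, `V' = P X + R V` with
`X(t₀) = Z₀`, `V(t₀) = 1` is linear with locally integrable coefficients, so it has a solution on
`[t₀, ∞)` (`exists_riccati_linearization`), and `Z = X V⁻¹` solves the Riccati equation as long as
`V` is invertible (`isRiccatiSolutionOn_mul_inv`). With `W = U⁻¹ X - Λ V` (the former `W`, multiplied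
by `V`), the Hermitian form `N = V* W + W* V`, which is congruent to the gap through `V`, satisfies
`N' = μ N + 2 W* A W - V* (T + T*) V ≥ μ N`
(`ae_hasMatrixDerivAt_linearizationForm`, `formGrowth_posSemidef`). By Gronwall's inequality
`N(t) ≥ exp (∫ μ) N(t₀)`, so that positivity, strict or not, persists.

It remains to see that `V` never degenerates, even when `N(t₀)` is only semidefinite
(`det_ne_zero_of_linearizationForm_posSemidef`). If `V(t₁) ξ = 0`, then `ξ* N ξ` vanishes at `t₁`,
hence on all of `[t₀, t₁]`; then its growth vanishes too, so `A W ξ = 0` almost everywhere, and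
`V ξ` solves the homogeneous equation `(V ξ)' = (A Λ + R) V ξ`. As it vanishes at `t₁`, it vanishes
at `t₀`, where it equals `ξ`.

Uniqueness holds because the difference of two solutions solves a linear equation. Both uniqueness
arguments rest on a Gronwall inequality for absolutely continuous functions
(`AbsolutelyContinuousOnInterval.exp_integral_mul_le`), and existence on a contraction in a weighted
supremum norm (`exists_continuous_eq_add_integral`).
-/

/-! ### Absolutely continuous functions -/

/-- A function whose increments are dominated by those of an absolutely continuous function is
absolutely continuous. -/
theorem AbsolutelyContinuousOnInterval.of_dist_le {X Y : Type*} [PseudoMetricSpace X]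
    [PseudoMetricSpace Y] {f : ℝ → X} {g : ℝ → Y} {a b : ℝ} (K : ℝ)
    (hf : AbsolutelyContinuousOnInterval f a b)
    (h : ∀ x ∈ uIcc a b, ∀ y ∈ uIcc a b, dist (g x) (g y) ≤ K * dist (f x) (f y)) :
    AbsolutelyContinuousOnInterval g a b := by
  unfold AbsolutelyContinuousOnInterval at hf ⊢
  refine squeeze_zero' (Filter.Eventually.of_forall fun E => ?_) ?_
    (by simpa using hf.const_mul K)
  · exact Finset.sum_nonneg fun i _ => dist_nonneg
  · filter_upwards [Filter.mem_inf_of_right (Filter.mem_principal_self _)] with E hE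
    rw [Finset.mul_sum]
    exact Finset.sum_le_sum fun i hi => h _ (hE.1 i hi).1 _ (hE.1 i hi).2

theorem AbsolutelyContinuousOnInterval.const {X : Type*} [PseudoMetricSpace X] (c : X) (a b : ℝ) :
    AbsolutelyContinuousOnInterval (fun _ => c) a b := by
  simpa [AbsolutelyContinuousOnInterval] using tendsto_const_nhds

theorem AbsolutelyContinuousOnInterval.finset_sum {ι F : Type*} [SeminormedAddCommGroup F]
    {f : ι → ℝ → F} {a b : ℝ} (s : Finset ι)
    (hf : ∀ i ∈ s, AbsolutelyContinuousOnInterval (f i) a b) :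
    AbsolutelyContinuousOnInterval (fun t => ∑ i ∈ s, f i t) a b := by
  classical
  induction s using Finset.induction_on with
  | empty => simpa using AbsolutelyContinuousOnInterval.const (0 : F) a b
  | insert i s hi ih =>
    simp only [Finset.sum_insert hi]
    exact (hf i (Finset.mem_insert_self i s)).fun_add
      (ih fun j hj => hf j (Finset.mem_insert_of_mem hj))

theorem AbsolutelyContinuousOnInterval.finset_prod {ι : Type*}
    {f : ι → ℝ → ℂ} {a b : ℝ} (s : Finset ι)
    (hf : ∀ i ∈ s, AbsolutelyContinuousOnInterval (f i) a b) :
    AbsolutelyContinuousOnInterval (fun t => ∏ i ∈ s, f i t) a b := by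
  classical
  induction s using Finset.induction_on with
  | empty => simpa using AbsolutelyContinuousOnInterval.const (1 : ℂ) a b
  | insert i s hi ih =>
    simp only [Finset.prod_insert hi]
    exact (hf i (Finset.mem_insert_self i s)).fun_smul
      (ih fun j hj => hf j (Finset.mem_insert_of_mem hj))

theorem AbsolutelyContinuousOnInterval.clm_comp {E F : Type*} [NormedAddCommGroup E]
    [NormedSpace ℝ E] [NormedAddCommGroup F] [NormedSpace ℝ F] {f : ℝ → E} {a b : ℝ}
    (hf : AbsolutelyContinuousOnInterval f a b) (T : E →L[ℝ] F) :
    AbsolutelyContinuousOnInterval (fun t => T (f t)) a b :=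
  hf.of_dist_le ‖T‖ fun x _ y _ => by
    rw [dist_eq_norm, dist_eq_norm, ← map_sub]
    exact T.le_opNorm _

theorem AbsolutelyContinuousOnInterval.ofReal_add_mul_I {f g : ℝ → ℝ} {a b : ℝ}
    (hf : AbsolutelyContinuousOnInterval f a b) (hg : AbsolutelyContinuousOnInterval g a b) :
    AbsolutelyContinuousOnInterval (fun t => (f t : ℂ) + g t * Complex.I) a b :=
  (hf.clm_comp Complex.ofRealCLM).fun_add
    ((hg.clm_comp Complex.ofRealCLM).fun_smul (.const Complex.I a b))

theorem AbsolutelyContinuousOnInterval.inv_complex {f : ℝ → ℂ} {a b : ℝ}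
    (hf : AbsolutelyContinuousOnInterval f a b) (h0 : ∀ t ∈ uIcc a b, f t ≠ 0) :
    AbsolutelyContinuousOnInterval (fun t => (f t)⁻¹) a b := by
  obtain ⟨C, hC⟩ := isCompact_uIcc.exists_bound_of_continuousOn (hf.continuousOn.inv₀ h0)
  refine hf.of_dist_le (C * C) fun x hx y hy => ?_
  have e : (f x)⁻¹ - (f y)⁻¹ = (f x)⁻¹ * (f y)⁻¹ * (f y - f x) := by
    field_simp [h0 x hx, h0 y hy]
  have hx' := hC x hx
  have hy' := hC y hy
  simp only [Pi.inv_apply] at hx' hy'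
  rw [dist_eq_norm, e, norm_mul, norm_mul, dist_comm, dist_eq_norm]
  gcongr
  exact (norm_nonneg _).trans hx'

theorem AbsolutelyContinuousOnInterval.exp {f : ℝ → ℝ} {a b : ℝ}
    (hf : AbsolutelyContinuousOnInterval f a b) :
    AbsolutelyContinuousOnInterval (fun t => Real.exp (f t)) a b := by
  obtain ⟨C, hC⟩ := hf.exists_bound
  refine hf.of_dist_le (Real.exp C) fun x hx y hy => ?_
  have key := Convex.norm_image_sub_le_of_norm_deriv_le (𝕜 := ℝ) (f := Real.exp)
    (s := Icc (-C) C) (x := f y) (y := f x) (C := Real.exp C)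
    (fun z _ => Real.differentiableAt_exp) (fun z hz => by simpa using hz.2)
    (convex_Icc _ _) (abs_le.1 (hC y hy)) (abs_le.1 (hC x hx))
  simpa [dist_eq_norm] using key

/-- Lebesgue's theorem for complex-valued functions: an absolutely continuous function is
differentiable almost everywhere. -/
theorem AbsolutelyContinuousOnInterval.ae_hasDerivAt_complex {f : ℝ → ℂ} {a b : ℝ}
    (hf : AbsolutelyContinuousOnInterval f a b) :
    ∀ᵐ t, t ∈ uIcc a b → HasDerivAt f (deriv f t) t := by
  filter_upwards [(hf.clm_comp Complex.reCLM).ae_differentiableAt,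
    (hf.clm_comp Complex.imCLM).ae_differentiableAt] with t h1 h2 ht
  have h := (h1 ht).hasDerivAt.ofReal_comp.add ((h2 ht).hasDerivAt.ofReal_comp.mul_const Complex.I)
  have e : f = (fun s => ((Complex.reCLM (f s) : ℝ) : ℂ)) +
      fun s => ((Complex.imCLM (f s) : ℝ) : ℂ) * Complex.I := by
    funext s
    simp [Complex.re_add_im]
  have hd : DifferentiableAt ℝ f t := by
    rw [e]
    exact h.differentiableAt
  exact hd.hasDerivAt

theorem IntervalIntegrable.absolutelyContinuousOnInterval_integral_complex {f : ℝ → ℂ} {a b : ℝ}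
    (hf : IntervalIntegrable f volume a b) :
    AbsolutelyContinuousOnInterval (fun t => ∫ s in a..t, f s) a b := by
  have hre : IntervalIntegrable (fun s => (f s).re) volume a b :=
    ⟨hf.1.re, hf.2.re⟩
  have him : IntervalIntegrable (fun s => (f s).im) volume a b :=
    ⟨hf.1.im, hf.2.im⟩
  refine ((hre.absolutelyContinuousOnInterval_intervalIntegral left_mem_uIcc).ofReal_add_mul_I
    (him.absolutelyContinuousOnInterval_intervalIntegral left_mem_uIcc)).of_dist_le 1 ?_
  have e : ∀ x ∈ uIcc a b, ∫ s in a..x, f s =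
      ((∫ s in a..x, (f s).re : ℝ) : ℂ) + (∫ s in a..x, (f s).im : ℝ) * Complex.I := by
    intro x hx
    have hx' : IntervalIntegrable f volume a x :=
      hf.mono_set (uIcc_subset_uIcc_left hx)
    have h1 := Complex.reCLM.intervalIntegral_comp_comm hx'
    have h2 := Complex.imCLM.intervalIntegral_comp_comm hx'
    simp only [Complex.reCLM_apply, Complex.imCLM_apply] at h1 h2
    rw [h1, h2, Complex.re_add_im]
  intro x hx y hy
  rw [e x hx, e y hy, one_mul]

/-! ### Gronwall's inequality for absolutely continuous functions -/

theorem IntervalIntegrable.ae_hasDerivAt_exp_integral {μ : ℝ → ℝ} {a b : ℝ}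
    (hμ : IntervalIntegrable μ volume a b) :
    ∀ᵐ t, t ∈ uIcc a b → HasDerivAt (fun x => Real.exp (∫ s in a..x, μ s))
      (Real.exp (∫ s in a..t, μ s) * μ t) t := by
  filter_upwards [hμ.ae_hasDerivAt_integral] with t ht hmem
  exact (ht hmem a left_mem_uIcc).exp

/-- Gronwall's inequality: the linear differential inequality `f' ≥ μ f` is integrated with the
factor `exp (-∫ μ)`. -/
theorem AbsolutelyContinuousOnInterval.exp_integral_mul_le {f μ : ℝ → ℝ} {a b : ℝ} (hab : a ≤ b)
    (hf : AbsolutelyContinuousOnInterval f a b) (hμ : IntervalIntegrable μ volume a b)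
    (h : ∀ᵐ t, t ∈ Icc a b → μ t * f t ≤ deriv f t) :
    Real.exp (∫ s in a..b, μ s) * f a ≤ f b := by
  have hm : IntervalIntegrable (fun t => -μ t) volume a b := hμ.neg
  have hg := ((hm.absolutelyContinuousOnInterval_intervalIntegral left_mem_uIcc).exp).fun_smul hf
  have hint := hg.integral_deriv_eq_sub
  have hpos : 0 ≤ ∫ x in a..b,
      deriv (fun t => Real.exp (∫ v in a..t, -μ v) • f t) x := by
    refine intervalIntegral.integral_nonneg_of_ae_restrict hab ?_
    rw [Filter.EventuallyLE, ae_restrict_iff' measurableSet_Icc]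
    filter_upwards [hm.ae_hasDerivAt_exp_integral, hf.ae_differentiableAt, h] with t h1 h2 h3 ht
    rw [uIcc_of_le hab] at h1 h2
    have hd := (h1 ht).smul (h2 ht).hasDerivAt
    change 0 ≤ deriv ((fun x => Real.exp (∫ s in a..x, -μ s)) • f) t
    rw [hd.deriv, smul_eq_mul, smul_eq_mul]
    have := mul_nonneg (Real.exp_pos (∫ s in a..t, -μ s)).le (sub_nonneg.2 (h3 ht))
    linarith
  rw [hint] at hpos
  simp only [intervalIntegral.integral_neg, intervalIntegral.integral_same,
    Real.exp_zero, smul_eq_mul, one_mul, Real.exp_neg] at hpos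
  have h1 : f a ≤ (Real.exp (∫ s in a..b, μ s))⁻¹ * f b := by linarith
  have h2 := mul_le_mul_of_nonneg_left h1 (Real.exp_pos (∫ s in a..b, μ s)).le
  rwa [mul_inv_cancel_left₀ (Real.exp_pos _).ne'] at h2

/-- Uniqueness for linear differential inequalities, forward and backward in time: absolutely
continuous functions with `|yᵢ'| ≤ κ ∑ |yⱼ|` that vanish at one point vanish identically. -/
theorem AbsolutelyContinuousOnInterval.eq_zero_of_norm_deriv_le {ι : Type*} [Fintype ι]
    {y : ι → ℝ → ℂ} {κ : ℝ → ℝ} {a b c : ℝ}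
    (hy : ∀ i, AbsolutelyContinuousOnInterval (y i) a b)
    (hκ : IntervalIntegrable κ volume a b) (hκ0 : ∀ t, 0 ≤ κ t)
    (h : ∀ᵐ t, t ∈ Icc a b → ∀ i, ‖deriv (y i) t‖ ≤ κ t * ∑ j, ‖y j t‖)
    (hc : c ∈ Icc a b) (hyc : ∀ i, y i c = 0) :
    ∀ t ∈ Icc a b, ∀ i, y i t = 0 := by
  have hab : a ≤ b := hc.1.trans hc.2
  set f : ℝ → ℝ := fun t => ∑ i, ‖y i t‖ ^ 2 with hfdef
  set ν : ℝ → ℝ := fun t => 2 * Fintype.card ι * κ t with hνdef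
  have hν : IntervalIntegrable ν volume a b := hκ.const_mul _
  have hf : AbsolutelyContinuousOnInterval f a b := by
    refine .finset_sum _ fun i _ => ?_
    have hre := (hy i).clm_comp Complex.reCLM
    have him := (hy i).clm_comp Complex.imCLM
    convert (hre.fun_smul hre).fun_add (him.fun_smul him) using 2 with t
    rw [← Complex.normSq_eq_norm_sq, Complex.normSq_apply]
    rfl
  have hf' : ∀ᵐ t, t ∈ Icc a b → HasDerivAt f (deriv f t) t ∧ |deriv f t| ≤ ν t * f t := by
    have hall : ∀ᵐ t, ∀ i, t ∈ uIcc a b → HasDerivAt (y i) (deriv (y i) t) t :=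
      ae_all_iff.2 fun i => (hy i).ae_hasDerivAt_complex
    filter_upwards [hall, h] with t h1 h2 ht
    rw [uIcc_of_le hab] at h1
    have hd : HasDerivAt f (∑ i, 2 * inner ℝ (y i t) (deriv (y i) t)) t :=
      HasDerivAt.fun_sum fun i _ => (h1 i ht).norm_sq
    refine ⟨hd.differentiableAt.hasDerivAt, ?_⟩
    rw [hd.deriv]
    calc |∑ i, 2 * inner ℝ (y i t) (deriv (y i) t)|
        ≤ ∑ i, |2 * inner ℝ (y i t) (deriv (y i) t)| := Finset.abs_sum_le_sum_abs _ _
      _ ≤ ∑ i, 2 * (‖y i t‖ * (κ t * ∑ j, ‖y j t‖)) := by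
        refine Finset.sum_le_sum fun i _ => ?_
        rw [abs_mul, abs_two]
        have := (abs_real_inner_le_norm (y i t) (deriv (y i) t)).trans
          (mul_le_mul_of_nonneg_left (h2 ht i) (norm_nonneg _))
        linarith
      _ = 2 * κ t * (∑ j, ‖y j t‖) ^ 2 := by
        rw [← Finset.mul_sum, ← Finset.sum_mul]
        ring
      _ ≤ 2 * κ t * (Fintype.card ι * f t) := by
        refine mul_le_mul_of_nonneg_left ?_ (mul_nonneg zero_le_two (hκ0 t))
        simpa using sq_sum_le_card_mul_sum_sq (s := Finset.univ) (f := fun j => ‖y j t‖)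
      _ = ν t * f t := by simp only [hνdef]; ring
  have hf0 : ∀ t, 0 ≤ f t := fun t => Finset.sum_nonneg fun i _ => sq_nonneg _
  have hfc : f c = 0 := by simp [hfdef, hyc]
  have hzero : ∀ t ∈ Icc a b, f t = 0 := by
    intro t ht
    refine le_antisymm ?_ (hf0 t)
    rcases le_total t c with htc | hct
    · -- Backward in time: `f' ≥ -ν f`.
      have hsub : uIcc t c ⊆ uIcc a b := by
        rw [uIcc_of_le htc, uIcc_of_le hab]
        exact Icc_subset_Icc ht.1 hc.2
      have key := (hf.mono hsub).exp_integral_mul_le htc (hν.neg.mono_set hsub) (by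
        filter_upwards [hf'] with s hs hmem
        have := abs_le.1 (hs ⟨ht.1.trans hmem.1, hmem.2.trans hc.2⟩).2
        simp only [Pi.neg_apply]
        linarith [this.1])
      rw [hfc] at key
      exact nonpos_of_mul_nonpos_right key (Real.exp_pos _)
    · -- Forward in time: `(-f)' ≥ ν (-f)`.
      have hsub : uIcc c t ⊆ uIcc a b := by
        rw [uIcc_of_le hct, uIcc_of_le hab]
        exact Icc_subset_Icc hc.1 ht.2
      have key := (hf.mono hsub).fun_neg.exp_integral_mul_le hct (hν.mono_set hsub) (by
        filter_upwards [hf'] with s hs hmem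
        have hs' := hs ⟨hc.1.trans hmem.1, hmem.2.trans ht.2⟩
        have := abs_le.1 hs'.2
        rw [hs'.1.fun_neg.deriv]
        linarith [this.2])
      rw [hfc] at key
      linarith
  intro t ht i
  have := (Finset.sum_eq_zero_iff_of_nonneg fun j _ => sq_nonneg ‖y j t‖).1 (hzero t ht) i
    (Finset.mem_univ i)
  simpa using this

/-! ### Linear differential equations with locally integrable coefficients -/

/-- Existence for the linear equation `y' = M(t) y` in integrated form. With
`k(t) = ∫ ‖M‖` over `[t₀, t]`, the equation for `w = e^{-2k} y` is a fixed-point problem for a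
contraction with constant `1/2` on bounded continuous functions, because
`e^{-2k(t)} ∫ e^{2k} ‖M‖ ≤ 1/2` over `[t₀, t]`. -/
theorem exists_continuous_eq_add_integral {E : Type*} [NormedAddCommGroup E] [NormedSpace ℝ E]
    [CompleteSpace E] {M : ℝ → E →L[ℝ] E} {t₀ : ℝ}
    (hM : ∀ t, t₀ ≤ t → IntervalIntegrable M volume t₀ t) (y₀ : E) :
    ∃ y : ℝ → E, Continuous y ∧ ∀ t, t₀ ≤ t →
      IntervalIntegrable (fun s => M s (y s)) volume t₀ t ∧
        y t = y₀ + ∫ s in t₀..t, M s (y s) := by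
  -- Replacing `M` by zero on `(-∞, t₀]` makes all the integrals below defined on the whole line.
  set N : ℝ → E →L[ℝ] E := (Ioi t₀).indicator M with hN
  have hNint : ∀ t, IntervalIntegrable N volume t₀ t := by
    intro t
    rcases le_total t₀ t with ht | ht
    · refine (hM t ht).congr fun s hs => ?_
      rw [uIoc_of_le ht] at hs
      rw [hN, indicator_of_mem (mem_Ioi.2 hs.1)]
    · refine (intervalIntegrable_const (c := (0 : E →L[ℝ] E))).congr fun s hs => ?_
      rw [uIoc_of_ge ht] at hs
      rw [hN, indicator_of_notMem (by simpa using hs.2)]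
  have hNn : ∀ t, IntervalIntegrable (fun s => ‖N s‖) volume t₀ t := fun t => (hNint t).norm
  have hNab : ∀ a b, IntervalIntegrable (fun s => ‖N s‖) volume a b := fun a b =>
    (hNn a).symm.trans (hNn b)
  set k : ℝ → ℝ := fun t => ∫ s in t₀..t, ‖N s‖ with hk
  have hkc : Continuous k := intervalIntegral.continuous_primitive hNab t₀
  set e : ℝ → ℝ := fun t => Real.exp (2 * k t) with he
  have hec : Continuous e := by fun_prop
  have hepos : ∀ t, 0 < e t := fun t => Real.exp_pos _
  have heint : ∀ t, IntervalIntegrable (fun s => e s * ‖N s‖) volume t₀ t := fun t =>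
    (hNn t).continuousOn_mul hec.continuousOn
  -- The weight absorbs the coefficient.
  have hweight : ∀ t, t₀ ≤ t → ∫ s in t₀..t, e s * ‖N s‖ ≤ e t / 2 := by
    intro t ht
    have hac := (((hNn t).const_mul 2).absolutelyContinuousOnInterval_intervalIntegral
      left_mem_uIcc).exp
    have h1 := hac.integral_deriv_eq_sub
    have h2 : ∫ s in t₀..t, deriv (fun x => Real.exp (∫ v in t₀..x, 2 * ‖N v‖)) s
        = ∫ s in t₀..t, 2 * (e s * ‖N s‖) := by
      refine intervalIntegral.integral_congr_ae ?_
      filter_upwards [((hNn t).const_mul 2).ae_hasDerivAt_exp_integral] with s hs hmem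
      rw [(hs (uIoc_subset_uIcc hmem)).deriv, intervalIntegral.integral_const_mul]
      simp only [he, hk]
      ring
    rw [h2, intervalIntegral.integral_const_mul, intervalIntegral.integral_const_mul] at h1
    simp only [intervalIntegral.integral_same, Real.exp_zero] at h1
    change 2 * (∫ s in t₀..t, e s * ‖N s‖) = e t - 1 at h1
    linarith
  have hMw : ∀ (w : BoundedContinuousFunction ℝ E) (t : ℝ),
      IntervalIntegrable (fun s => N s (e s • w s)) volume t₀ t := by
    intro w t
    have hc : Continuous fun s => e s • w s := hec.smul w.continuous
    refine ((hNn t).mul_continuousOn hc.norm.continuousOn).mono_fun ?_ ?_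
    · have h1 := (hNint t).def'.aestronglyMeasurable
      exact (ContinuousLinearMap.apply ℝ E).flip.aestronglyMeasurable_comp₂ h1
        hc.aestronglyMeasurable
    · refine Filter.Eventually.of_forall fun s => ?_
      dsimp only
      rw [Real.norm_of_nonneg (by positivity)]
      exact (N s).le_opNorm _
  have hbound : ∀ (w : BoundedContinuousFunction ℝ E) (t : ℝ), t₀ ≤ t →
      ‖∫ s in t₀..t, N s (e s • w s)‖ ≤ e t / 2 * ‖w‖ := by
    intro w t ht
    calc ‖∫ s in t₀..t, N s (e s • w s)‖ ≤ ∫ s in t₀..t, e s * ‖N s‖ * ‖w‖ := by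
          refine intervalIntegral.norm_integral_le_of_norm_le ht
            (Filter.Eventually.of_forall fun s _ => ?_) ((heint t).mul_const _)
          calc ‖N s (e s • w s)‖ ≤ ‖N s‖ * ‖e s • w s‖ := (N s).le_opNorm _
            _ = e s * ‖N s‖ * ‖w s‖ := by
              rw [norm_smul, Real.norm_of_nonneg (hepos s).le]; ring
            _ ≤ e s * ‖N s‖ * ‖w‖ := by
              have := hepos s
              gcongr
              exact w.norm_coe_le_norm s
      _ ≤ e t / 2 * ‖w‖ := by
          rw [intervalIntegral.integral_mul_const]
          exact mul_le_mul_of_nonneg_right (hweight t ht) (norm_nonneg _)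
  let φ : BoundedContinuousFunction ℝ E → ℝ → E := fun w t =>
    (e (max t t₀))⁻¹ • (y₀ + ∫ s in t₀..max t t₀, N s (e s • w s))
  have hφc : ∀ w, Continuous (φ w) := by
    intro w
    have h1 : Continuous fun t => ∫ s in t₀..t, N s (e s • w s) :=
      intervalIntegral.continuous_primitive (fun a b => (hMw w a).symm.trans (hMw w b)) t₀
    have h2 : Continuous fun t : ℝ => max t t₀ := by fun_prop
    exact ((hec.comp h2).inv₀ fun t => (hepos _).ne').smul (continuous_const.add (h1.comp h2))
  have he1 : ∀ t, t₀ ≤ t → 1 ≤ e t := fun t ht =>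
    Real.one_le_exp (mul_nonneg zero_le_two
      (intervalIntegral.integral_nonneg ht fun s _ => norm_nonneg _))
  have hφb : ∀ w t, ‖φ w t‖ ≤ ‖y₀‖ + ‖w‖ / 2 := by
    intro w t
    have ht := le_max_right t t₀
    have hp := hepos (max t t₀)
    rw [norm_smul, norm_inv, Real.norm_of_nonneg hp.le, inv_mul_le_iff₀ hp]
    calc ‖y₀ + ∫ s in t₀..max t t₀, N s (e s • w s)‖
        ≤ 1 * ‖y₀‖ + e (max t t₀) / 2 * ‖w‖ := by
          rw [one_mul]
          exact (norm_add_le _ _).trans (add_le_add_right (hbound w _ ht) _)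
      _ ≤ e (max t t₀) * ‖y₀‖ + e (max t t₀) / 2 * ‖w‖ := by
          gcongr
          exact he1 _ ht
      _ = e (max t t₀) * (‖y₀‖ + ‖w‖ / 2) := by ring
  let Φ : BoundedContinuousFunction ℝ E → BoundedContinuousFunction ℝ E := fun w =>
    BoundedContinuousFunction.ofNormedAddCommGroup (φ w) (hφc w) _ (hφb w)
  have hΦ : ContractingWith (1 / 2) Φ := by
    refine ⟨by norm_num, LipschitzWith.of_dist_le_mul fun w v => ?_⟩
    rw [dist_eq_norm, dist_eq_norm]
    refine (BoundedContinuousFunction.norm_le (by positivity)).2 fun t => ?_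
    have ht := le_max_right t t₀
    have hp := hepos (max t t₀)
    have hsub : φ w t - φ v t = (e (max t t₀))⁻¹ •
        ∫ s in t₀..max t t₀, N s (e s • (w - v) s) := by
      simp only [φ, ← smul_sub, add_sub_add_left_eq_sub]
      rw [← intervalIntegral.integral_sub (hMw w _) (hMw v _)]
      simp [smul_sub]
    change ‖φ w t - φ v t‖ ≤ _
    rw [hsub, norm_smul, norm_inv, Real.norm_of_nonneg hp.le, inv_mul_le_iff₀ hp]
    refine (hbound (w - v) _ ht).trans (le_of_eq ?_)
    push_cast
    ring
  obtain ⟨w, hw, -⟩ := hΦ.exists_fixedPoint 0 (edist_ne_top _ _)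
  refine ⟨fun t => e t • w t, hec.smul w.continuous, fun t ht => ?_⟩
  have hcongr : ∀ s ∈ uIoc t₀ t, N s (e s • w s) = M s (e s • w s) := by
    intro s hs
    rw [uIoc_of_le ht] at hs
    rw [hN, indicator_of_mem (mem_Ioi.2 hs.1)]
  refine ⟨(hMw w t).congr hcongr, ?_⟩
  have hfix : w t = φ w t := by
    conv_lhs => rw [← hw.eq]
    rfl
  rw [← intervalIntegral.integral_congr_ae (Filter.Eventually.of_forall hcongr)]
  change e t • w t = _
  rw [hfix]
  simp only [φ, max_eq_left ht]
  rw [smul_smul, mul_inv_cancel₀ (hepos t).ne', one_smul]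

theorem ae_imp_of_forall_Icc {p : ℝ → Prop} {a : ℝ}
    (h : ∀ b, a ≤ b → ∀ᵐ t, t ∈ Icc a b → p t) : ∀ᵐ t, a ≤ t → p t := by
  have hall : ∀ᵐ t, ∀ m : ℕ, t ∈ Icc a (a + m) → p t :=
    ae_all_iff.2 fun m => h _ (le_add_of_nonneg_right m.cast_nonneg)
  filter_upwards [hall] with t ht hat
  obtain ⟨m, hm⟩ := exists_nat_ge (t - a)
  exact ht m ⟨hat, by linarith⟩

/-- Global existence for a linear system `yᵢ' = ∑ⱼ Hᵢⱼ yⱼ` with locally integrable coefficients,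
in the sense of Carathéodory. -/
theorem exists_solution_linear_system {ι : Type*} [Fintype ι] {H : ℝ → ι → ι → ℂ} {t₀ : ℝ}
    (hH : ∀ i j t, t₀ ≤ t → IntervalIntegrable (fun s => H s i j) volume t₀ t) (y₀ : ι → ℂ) :
    ∃ y : ι → ℝ → ℂ, (∀ i, y i t₀ = y₀ i) ∧
      (∀ i t, t₀ ≤ t → AbsolutelyContinuousOnInterval (y i) t₀ t) ∧
      ∀ᵐ t, t₀ ≤ t → ∀ i, HasDerivAt (y i) (∑ j, H t i j * y j t) t := by
  classical
  let Λ : (ι → ι → ℂ) →ₗ[ℝ] ((ι → ℂ) →L[ℝ] (ι → ℂ)) :=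
    { toFun := fun G => LinearMap.toContinuousLinearMap
        ((Matrix.mulVecLin (Matrix.of G)).restrictScalars ℝ)
      map_add' := fun G G' => by
        ext v i
        simp [Matrix.mulVec, dotProduct, add_mul, Finset.sum_add_distrib]
      map_smul' := fun c G => by
        ext v i
        simp [Matrix.mulVec, dotProduct, Finset.mul_sum, mul_assoc] }
  have hΛ : ∀ G v i, Λ G v i = ∑ j, G i j * v j := fun G v i => rfl
  have hM : ∀ t, t₀ ≤ t → IntervalIntegrable (fun s => Λ (H s)) volume t₀ t := by
    intro t ht
    have h1 : ∀ i j, IntegrableOn (fun s => H s i j) (Ioc t₀ t) := fun i j =>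
      (intervalIntegrable_iff_integrableOn_Ioc_of_le ht).1 (hH i j t ht)
    have h2 : IntegrableOn H (Ioc t₀ t) :=
      Integrable.of_eval fun i => Integrable.of_eval fun j => h1 i j
    exact (intervalIntegrable_iff_integrableOn_Ioc_of_le ht).2
      ((LinearMap.toContinuousLinearMap Λ).integrable_comp h2)
  obtain ⟨y, -, hy⟩ := exists_continuous_eq_add_integral hM y₀
  have hint : ∀ i t, t₀ ≤ t → IntervalIntegrable (fun s => Λ (H s) (y s) i) volume t₀ t := by
    intro i t ht
    have h1 := (intervalIntegrable_iff_integrableOn_Ioc_of_le ht).1 (hy t ht).1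
    exact (intervalIntegrable_iff_integrableOn_Ioc_of_le ht).2 (Integrable.eval h1 i)
  have hyi : ∀ i t, t₀ ≤ t → y t i = y₀ i + ∫ s in t₀..t, Λ (H s) (y s) i := by
    intro i t ht
    have h1 := (ContinuousLinearMap.proj (R := ℝ) (φ := fun _ : ι => ℂ) i).intervalIntegral_comp_comm
      (hy t ht).1
    simp only [ContinuousLinearMap.proj_apply] at h1
    rw [h1]
    exact congrFun (hy t ht).2 i
  refine ⟨fun i t => y t i, fun i => by simpa using hyi i t₀ le_rfl, fun i t ht => ?_, ?_⟩
  · refine ((AbsolutelyContinuousOnInterval.const (y₀ i) t₀ t).fun_add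
      (hint i t ht).absolutelyContinuousOnInterval_integral_complex).of_dist_le 1 ?_
    intro s hs r hr
    rw [uIcc_of_le ht] at hs hr
    dsimp only
    rw [one_mul, hyi i s hs.1, hyi i r hr.1]
  · refine ae_imp_of_forall_Icc fun b hb => ?_
    have hall : ∀ᵐ t, ∀ i, t ∈ uIcc t₀ b → ∀ c ∈ uIcc t₀ b,
        HasDerivAt (fun x => ∫ s in c..x, Λ (H s) (y s) i) (Λ (H t) (y t) i) t :=
      ae_all_iff.2 fun i => (hint i b hb).ae_hasDerivAt_integral
    have hne : ∀ᵐ t : ℝ, t ≠ t₀ := by simp [ae_iff, measure_singleton]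
    filter_upwards [hall, hne] with t ht htne hmem i
    rw [uIcc_of_le hb] at ht
    have hlt : t₀ < t := lt_of_le_of_ne hmem.1 htne.symm
    have h1 := (ht i hmem t₀ (left_mem_Icc.2 hb)).const_add (y₀ i)
    rw [hΛ] at h1
    refine h1.congr_of_eventuallyEq ?_
    filter_upwards [Ioi_mem_nhds hlt] with s hs
    exact hyi i s (le_of_lt hs)

/-! ### Calculus of matrix functions -/

section MatrixFunctions

variable {n : ℕ}

/-- Entrywise differentiability of a matrix function at a point, with derivative `F'`. -/
def HasMatrixDerivAt (F : ℝ → Matrix (Fin n) (Fin n) ℂ) (F' : Matrix (Fin n) (Fin n) ℂ)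
    (t : ℝ) : Prop :=
  ∀ i j, HasDerivAt (fun s => F s i j) (F' i j) t

namespace HasMatrixDerivAt

variable {F G : ℝ → Matrix (Fin n) (Fin n) ℂ} {F' G' : Matrix (Fin n) (Fin n) ℂ} {t : ℝ}

theorem matrixDeriv_eq (hF : HasMatrixDerivAt F F' t) : matrixDeriv F t = F' := by
  ext i j
  exact (hF i j).deriv

theorem const (C : Matrix (Fin n) (Fin n) ℂ) (t : ℝ) : HasMatrixDerivAt (fun _ => C) 0 t :=
  fun i j => hasDerivAt_const t (C i j)

theorem unique (hF : HasMatrixDerivAt F F' t) (hF' : HasMatrixDerivAt F G' t) : F' = G' := by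
  rw [← hF.matrixDeriv_eq, hF'.matrixDeriv_eq]

theorem add (hF : HasMatrixDerivAt F F' t) (hG : HasMatrixDerivAt G G' t) :
    HasMatrixDerivAt (fun s => F s + G s) (F' + G') t :=
  fun i j => (hF i j).add (hG i j)

theorem sub (hF : HasMatrixDerivAt F F' t) (hG : HasMatrixDerivAt G G' t) :
    HasMatrixDerivAt (fun s => F s - G s) (F' - G') t :=
  fun i j => (hF i j).sub (hG i j)

theorem mul (hF : HasMatrixDerivAt F F' t) (hG : HasMatrixDerivAt G G' t) :
    HasMatrixDerivAt (fun s => F s * G s) (F' * G t + F t * G') t := by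
  intro i j
  have h := HasDerivAt.fun_sum (u := Finset.univ) fun k _ => (hF i k).mul (hG k j)
  simpa [Matrix.mul_apply, Finset.sum_add_distrib] using h

theorem conjTranspose (hF : HasMatrixDerivAt F F' t) :
    HasMatrixDerivAt (fun s => (F s)ᴴ) F'ᴴ t :=
  fun i j => (hF j i).star

theorem dotProduct_mulVec (hF : HasMatrixDerivAt F F' t) (ξ : Fin n → ℂ) :
    HasDerivAt (fun s => (star ξ ⬝ᵥ F s *ᵥ ξ).re) (star ξ ⬝ᵥ F' *ᵥ ξ).re t := by
  have h : HasDerivAt (fun s => star ξ ⬝ᵥ F s *ᵥ ξ) (star ξ ⬝ᵥ F' *ᵥ ξ) t := by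
    simp only [dotProduct, Matrix.mulVec]
    exact HasDerivAt.fun_sum fun i _ =>
      (HasDerivAt.fun_sum fun j _ => (hF i j).mul_const (ξ j)).const_mul _
  exact Complex.reCLM.hasFDerivAt.comp_hasDerivAt t h

/-- The derivative of the inverse, obtained by differentiating `F F⁻¹ = 1`. -/
theorem inv_eq (hF : HasMatrixDerivAt F F' t) (hG : HasMatrixDerivAt (fun s => (F s)⁻¹) G' t)
    (hdet : ∀ᶠ s in nhds t, (F s).det ≠ 0) : G' = -((F t)⁻¹ * F' * (F t)⁻¹) := by
  have h1 := hF.mul hG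
  have h2 : HasMatrixDerivAt (fun s => F s * (F s)⁻¹) 0 t := by
    intro i j
    refine (hasDerivAt_const t ((1 : Matrix (Fin n) (Fin n) ℂ) i j)).congr_of_eventuallyEq ?_
    filter_upwards [hdet] with s hs
    rw [Matrix.mul_nonsing_inv _ (isUnit_iff_ne_zero.2 hs)]
  have h3 := h1.unique h2
  have hu : IsUnit (F t).det := isUnit_iff_ne_zero.2 hdet.self_of_nhds
  have h4 : (F t)⁻¹ * (F' * (F t)⁻¹ + F t * G') = 0 := by rw [h3, mul_zero]
  rw [mul_add, ← mul_assoc _ (F t), Matrix.nonsing_inv_mul _ hu, one_mul, ← mul_assoc] at h4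
  exact eq_neg_of_add_eq_zero_right h4

end HasMatrixDerivAt

namespace MatrixAbsolutelyContinuousOn

variable {F G : ℝ → Matrix (Fin n) (Fin n) ℂ} {I : Set ℝ}

theorem mono {J : Set ℝ} (hF : MatrixAbsolutelyContinuousOn F I) (h : J ⊆ I) :
    MatrixAbsolutelyContinuousOn F J :=
  fun a ha b hb hab i j => hF a (h ha) b (h hb) hab i j

theorem const (C : Matrix (Fin n) (Fin n) ℂ) (I : Set ℝ) :
    MatrixAbsolutelyContinuousOn (fun _ => C) I :=
  fun a _ b _ _ i j => .const (C i j) a b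

theorem add (hF : MatrixAbsolutelyContinuousOn F I) (hG : MatrixAbsolutelyContinuousOn G I) :
    MatrixAbsolutelyContinuousOn (fun t => F t + G t) I :=
  fun a ha b hb hab i j => (hF a ha b hb hab i j).fun_add (hG a ha b hb hab i j)

theorem sub (hF : MatrixAbsolutelyContinuousOn F I) (hG : MatrixAbsolutelyContinuousOn G I) :
    MatrixAbsolutelyContinuousOn (fun t => F t - G t) I :=
  fun a ha b hb hab i j => (hF a ha b hb hab i j).fun_sub (hG a ha b hb hab i j)

theorem mul (hF : MatrixAbsolutelyContinuousOn F I) (hG : MatrixAbsolutelyContinuousOn G I) :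
    MatrixAbsolutelyContinuousOn (fun t => F t * G t) I := by
  intro a ha b hb hab i j
  simp only [Matrix.mul_apply]
  exact .finset_sum _ fun k _ => (hF a ha b hb hab i k).fun_smul (hG a ha b hb hab k j)

theorem conjTranspose (hF : MatrixAbsolutelyContinuousOn F I) :
    MatrixAbsolutelyContinuousOn (fun t => (F t)ᴴ) I :=
  fun a ha b hb hab i j => (hF a ha b hb hab j i).of_dist_le 1 fun x _ y _ => by
    simp [Matrix.conjTranspose_apply, dist_eq_norm, ← map_sub]

theorem det (hF : MatrixAbsolutelyContinuousOn F I) {a b : ℝ} (ha : a ∈ I) (hb : b ∈ I)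
    (hab : a ≤ b) : AbsolutelyContinuousOnInterval (fun t => (F t).det) a b := by
  simp only [Matrix.det_apply']
  exact .finset_sum _ fun σ _ =>
    (AbsolutelyContinuousOnInterval.const ((Equiv.Perm.sign σ : ℤ) : ℂ) a b).fun_smul
      (.finset_prod _ fun i _ => hF a ha b hb hab (σ i) i)

theorem inv (hF : MatrixAbsolutelyContinuousOn F I) (hI : I.OrdConnected)
    (hdet : ∀ t ∈ I, (F t).det ≠ 0) :
    MatrixAbsolutelyContinuousOn (fun t => (F t)⁻¹) I := by
  intro a ha b hb hab i j
  have hadj : AbsolutelyContinuousOnInterval (fun t => (F t).adjugate i j) a b := by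
    simp only [Matrix.adjugate_apply]
    refine MatrixAbsolutelyContinuousOn.det (F := fun t => (F t).updateRow j (Pi.single i 1))
      (I := I) (fun a ha b hb hab k l => ?_) ha hb hab
    rcases eq_or_ne k j with rfl | hk
    · simpa [Matrix.updateRow_self] using .const _ a b
    · simpa [Matrix.updateRow_ne hk] using hF a ha b hb hab k l
  have hd := (hF.det ha hb hab).inv_complex fun t ht =>
    hdet t (hI.out ha hb (by rwa [uIcc_of_le hab] at ht))
  simpa [Matrix.inv_def, Ring.inverse_eq_inv'] using hd.fun_smul hadj

theorem continuousOn_Icc {a b : ℝ} (hF : MatrixAbsolutelyContinuousOn F (Icc a b)) (hab : a ≤ b)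
    (i j : Fin n) : ContinuousOn (fun t => F t i j) (uIcc a b) :=
  (hF a (left_mem_Icc.2 hab) b (right_mem_Icc.2 hab) hab i j).continuousOn

theorem ae_hasMatrixDerivAt_Icc {a b : ℝ} (hF : MatrixAbsolutelyContinuousOn F (Icc a b)) :
    ∀ᵐ t, t ∈ Icc a b → HasMatrixDerivAt F (matrixDeriv F t) t := by
  rcases lt_or_ge b a with h | hab
  · simp [Icc_eq_empty_of_lt h]
  have hall : ∀ᵐ t, ∀ i j, t ∈ uIcc a b →
      HasDerivAt (fun s => F s i j) (deriv (fun s => F s i j) t) t :=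
    ae_all_iff.2 fun i => ae_all_iff.2 fun j =>
      (hF a (left_mem_Icc.2 hab) b (right_mem_Icc.2 hab) hab i j).ae_hasDerivAt_complex
  filter_upwards [hall] with t ht hmem i j
  rw [← uIcc_of_le hab] at hmem
  exact ht i j hmem

theorem ae_hasMatrixDerivAt {t₀ : ℝ} (hF : MatrixAbsolutelyContinuousOn F (Ici t₀)) :
    ∀ᵐ t, t₀ ≤ t → HasMatrixDerivAt F (matrixDeriv F t) t :=
  ae_imp_of_forall_Icc fun _ _ => (hF.mono Icc_subset_Ici_self).ae_hasMatrixDerivAt_Icc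

theorem ae_hasMatrixDerivAt_inv {t₀ : ℝ} (hF : MatrixAbsolutelyContinuousOn F (Ici t₀))
    (hdet : ∀ t, t₀ ≤ t → (F t).det ≠ 0) :
    ∀ᵐ t, t₀ ≤ t → HasMatrixDerivAt (fun s => (F s)⁻¹)
      (-((F t)⁻¹ * matrixDeriv F t * (F t)⁻¹)) t := by
  have hne : ∀ᵐ t : ℝ, t ≠ t₀ := by simp [ae_iff, measure_singleton]
  filter_upwards [hF.ae_hasMatrixDerivAt, (hF.inv ordConnected_Ici hdet).ae_hasMatrixDerivAt, hne]
    with t h1 h2 h3 ht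
  have hlt : t₀ < t := lt_of_le_of_ne ht h3.symm
  have h := (h1 ht).inv_eq (h2 ht) (by
    filter_upwards [Ioi_mem_nhds hlt] with s hs
    exact hdet s (le_of_lt hs))
  rw [← h]
  exact h2 ht

theorem dotProduct_mulVec (hF : MatrixAbsolutelyContinuousOn F I) {a b : ℝ} (ha : a ∈ I)
    (hb : b ∈ I) (hab : a ≤ b) (ξ : Fin n → ℂ) :
    AbsolutelyContinuousOnInterval (fun t => (star ξ ⬝ᵥ F t *ᵥ ξ).re) a b := by
  have h : AbsolutelyContinuousOnInterval (fun t => star ξ ⬝ᵥ F t *ᵥ ξ) a b := by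
    simp only [dotProduct, Matrix.mulVec]
    exact .finset_sum _ fun i _ => (AbsolutelyContinuousOnInterval.const (star ξ i) a b).fun_smul
      (.finset_sum _ fun j _ => (hF a ha b hb hab i j).fun_smul (.const (ξ j) a b))
  exact h.clm_comp Complex.reCLM

end MatrixAbsolutelyContinuousOn

/-- Entrywise interval integrability of a matrix function. -/
def MatrixIntervalIntegrable (F : ℝ → Matrix (Fin n) (Fin n) ℂ) (a b : ℝ) : Prop :=
  ∀ i j, IntervalIntegrable (fun t => F t i j) volume a b

namespace MatrixIntervalIntegrable

theorem zero (a b : ℝ) : MatrixIntervalIntegrable (fun _ => (0 : Matrix (Fin n) (Fin n) ℂ)) a b :=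
  fun _ _ => intervalIntegrable_const

variable {F G : ℝ → Matrix (Fin n) (Fin n) ℂ} {a b : ℝ}

theorem neg (hF : MatrixIntervalIntegrable F a b) :
    MatrixIntervalIntegrable (fun t => -F t) a b :=
  fun i j => (hF i j).neg

theorem add (hF : MatrixIntervalIntegrable F a b) (hG : MatrixIntervalIntegrable G a b) :
    MatrixIntervalIntegrable (fun t => F t + G t) a b :=
  fun i j => (hF i j).add (hG i j)

theorem mul_continuousOn (hF : MatrixIntervalIntegrable F a b)
    (hG : ∀ i j, ContinuousOn (fun t => G t i j) (uIcc a b)) :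
    MatrixIntervalIntegrable (fun t => F t * G t) a b := by
  intro i j
  simp only [Matrix.mul_apply]
  simpa only [Finset.sum_fn] using IntervalIntegrable.sum Finset.univ
    fun k _ => (hF i k).mul_continuousOn (hG k j)

theorem continuousOn_mul (hF : MatrixIntervalIntegrable F a b)
    (hG : ∀ i j, ContinuousOn (fun t => G t i j) (uIcc a b)) :
    MatrixIntervalIntegrable (fun t => G t * F t) a b := by
  intro i j
  simp only [Matrix.mul_apply]
  simpa only [Finset.sum_fn] using IntervalIntegrable.sum Finset.univ
    fun k _ => (hF k j).continuousOn_mul (hG i k)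

theorem sum_norm (hF : MatrixIntervalIntegrable F a b) :
    IntervalIntegrable (fun t => ∑ i, ∑ j, ‖F t i j‖) volume a b := by
  simpa only [Finset.sum_fn] using IntervalIntegrable.sum Finset.univ fun i _ =>
    IntervalIntegrable.sum Finset.univ fun j _ => (hF i j).norm

end MatrixIntervalIntegrable

theorem MatrixLocallyIntegrableOn.matrixIntervalIntegrable
    {F : ℝ → Matrix (Fin n) (Fin n) ℂ} {t₀ a b : ℝ}
    (hF : MatrixLocallyIntegrableOn F (Ici t₀)) (ha : t₀ ≤ a) (hab : a ≤ b) :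
    MatrixIntervalIntegrable F a b := by
  intro i j
  rw [intervalIntegrable_iff_integrableOn_Icc_of_le hab]
  exact (hF i j).integrableOn_compact_subset (fun x hx => ha.trans hx.1) isCompact_Icc

theorem norm_mul_apply_le_sum (A B : Matrix (Fin n) (Fin n) ℂ) (i j : Fin n) :
    ‖(A * B) i j‖ ≤ (∑ k, ∑ l, ‖A k l‖) * ∑ k, ∑ l, ‖B k l‖ := by
  rw [Matrix.mul_apply]
  calc ‖∑ k, A i k * B k j‖ ≤ ∑ k, ‖A i k‖ * ‖B k j‖ :=
        (norm_sum_le _ _).trans_eq (by simp only [norm_mul])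
    _ ≤ ∑ k, ‖A i k‖ * ∑ k, ∑ l, ‖B k l‖ := by
        refine Finset.sum_le_sum fun k _ => mul_le_mul_of_nonneg_left ?_ (norm_nonneg _)
        exact (Finset.single_le_sum (f := fun l => ‖B k l‖) (fun _ _ => norm_nonneg _)
          (Finset.mem_univ j)).trans (Finset.single_le_sum (f := fun k => ∑ l, ‖B k l‖)
          (fun _ _ => Finset.sum_nonneg fun _ _ => norm_nonneg _) (Finset.mem_univ k))
    _ = (∑ k, ‖A i k‖) * ∑ k, ∑ l, ‖B k l‖ := (Finset.sum_mul _ _ _).symm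
    _ ≤ _ := by
        refine mul_le_mul_of_nonneg_right ?_
          (Finset.sum_nonneg fun _ _ => Finset.sum_nonneg fun _ _ => norm_nonneg _)
        exact Finset.single_le_sum (f := fun k => ∑ l, ‖A k l‖)
          (fun _ _ => Finset.sum_nonneg fun _ _ => norm_nonneg _) (Finset.mem_univ i)

/-- Two-sided linear matrix equations have unique solutions: a matrix function satisfying
`D' = -(A D + D B)` almost everywhere and vanishing at one point vanishes. -/
theorem eq_zero_of_hasMatrixDerivAt_two_sided {D A B : ℝ → Matrix (Fin n) (Fin n) ℂ} {a b c : ℝ}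
    (hD : MatrixAbsolutelyContinuousOn D (Icc a b)) (hA : MatrixIntervalIntegrable A a b)
    (hB : MatrixIntervalIntegrable B a b)
    (h : ∀ᵐ t, t ∈ Icc a b → matrixDeriv D t = -(A t * D t + D t * B t))
    (hc : c ∈ Icc a b) (hDc : D c = 0) : ∀ t ∈ Icc a b, D t = 0 := by
  have hab : a ≤ b := hc.1.trans hc.2
  have key := AbsolutelyContinuousOnInterval.eq_zero_of_norm_deriv_le
    (y := fun (p : Fin n × Fin n) t => D t p.1 p.2)
    (fun p => hD a (left_mem_Icc.2 hab) b (right_mem_Icc.2 hab) hab p.1 p.2)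
    (hA.sum_norm.add hB.sum_norm)
    (fun t => by
      have : ∀ M : Matrix (Fin n) (Fin n) ℂ, 0 ≤ ∑ i, ∑ j, ‖M i j‖ := fun M =>
        Finset.sum_nonneg fun _ _ => Finset.sum_nonneg fun _ _ => norm_nonneg _
      exact add_nonneg (this _) (this _))
    (by
      filter_upwards [h] with t ht hmem p
      have e : deriv (fun s => D s p.1 p.2) t = -((A t * D t) p.1 p.2 + (D t * B t) p.1 p.2) := by
        have := congrFun (congrFun (ht hmem) p.1) p.2
        simpa [matrixDeriv] using this
      rw [e, norm_neg, Fintype.sum_prod_type]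
      refine (norm_add_le _ _).trans ?_
      have h1 := norm_mul_apply_le_sum (A t) (D t) p.1 p.2
      have h2 := norm_mul_apply_le_sum (D t) (B t) p.1 p.2
      linarith)
    hc (fun p => by simp [hDc])
  intro t ht
  ext i j
  exact key t ht (i, j)

/-! ### The Riccati equation and its linearization -/

/-- Two solutions with the same value at the left end point agree: their difference `D = Y - Z`
satisfies the two-sided linear equation `D' = -((Y P + Q) D + D (P Z + R))`. -/
theorem IsRiccatiSolutionOn.eq_of_eq_left {P Q R S Y Z : ℝ → Matrix (Fin n) (Fin n) ℂ} {a b : ℝ}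
    (hab : a ≤ b) (hP : MatrixIntervalIntegrable P a b) (hQ : MatrixIntervalIntegrable Q a b)
    (hR : MatrixIntervalIntegrable R a b) (hY : IsRiccatiSolutionOn P Q R S (Icc a b) Y)
    (hZ : IsRiccatiSolutionOn P Q R S (Icc a b) Z) (h : Y a = Z a) : Y b = Z b := by
  have key := eq_zero_of_hasMatrixDerivAt_two_sided (hY.1.sub hZ.1)
    ((hP.continuousOn_mul (hY.1.continuousOn_Icc hab)).add hQ)
    ((hP.mul_continuousOn (hZ.1.continuousOn_Icc hab)).add hR) (by
      filter_upwards [hY.1.ae_hasMatrixDerivAt_Icc, hZ.1.ae_hasMatrixDerivAt_Icc, hY.2, hZ.2]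
        with t h1 h2 h3 h4 ht
      rw [((h1 ht).sub (h2 ht)).matrixDeriv_eq]
      have e3 := h3 ht
      have e4 := h4 ht
      rw [add_assoc, add_assoc, add_assoc, ← eq_neg_iff_add_eq_zero] at e3 e4
      rw [e3, e4]
      noncomm_ring) (left_mem_Icc.2 hab) (by simp [h])
  exact sub_eq_zero.1 (key b (right_mem_Icc.2 hab))

/-- Global existence for the linear system `X' = -(Q X + S V)`, `V' = P X + R V`, whose solutions
give solutions `X V⁻¹` of the Riccati equation wherever `V` is invertible. -/
theorem exists_riccati_linearization {P Q R S : ℝ → Matrix (Fin n) (Fin n) ℂ} {t₀ : ℝ}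
    (hP : MatrixLocallyIntegrableOn P (Ici t₀)) (hQ : MatrixLocallyIntegrableOn Q (Ici t₀))
    (hR : MatrixLocallyIntegrableOn R (Ici t₀)) (hS : MatrixLocallyIntegrableOn S (Ici t₀))
    (Z₀ : Matrix (Fin n) (Fin n) ℂ) :
    ∃ X V : ℝ → Matrix (Fin n) (Fin n) ℂ,
      MatrixAbsolutelyContinuousOn X (Ici t₀) ∧ MatrixAbsolutelyContinuousOn V (Ici t₀) ∧
      X t₀ = Z₀ ∧ V t₀ = 1 ∧ ∀ᵐ t, t₀ ≤ t →
        HasMatrixDerivAt X (-(Q t * X t + S t * V t)) t ∧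
        HasMatrixDerivAt V (P t * X t + R t * V t) t := by
  have hH : ∀ i j t, t₀ ≤ t →
      IntervalIntegrable (fun s => Matrix.fromBlocks (-Q s) (-S s) (P s) (R s) i j)
        volume t₀ t := by
    intro i j t ht
    rcases i with i | i <;> rcases j with j | j
    · exact (hQ.matrixIntervalIntegrable le_rfl ht i j).neg
    · exact (hS.matrixIntervalIntegrable le_rfl ht i j).neg
    · exact hP.matrixIntervalIntegrable le_rfl ht i j
    · exact hR.matrixIntervalIntegrable le_rfl ht i j
  choose y hy0 hyac hyd using fun c : Fin n => exists_solution_linear_system hH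
    (Sum.elim (fun i => Z₀ i c) fun i => (1 : Matrix (Fin n) (Fin n) ℂ) i c)
  have hac : ∀ c i a, a ∈ Ici t₀ → ∀ b, b ∈ Ici t₀ → a ≤ b →
      AbsolutelyContinuousOnInterval (y c i) a b := fun c i a ha b hb hab =>
    (hyac c i b hb).mono (by
      rw [uIcc_of_le hab, uIcc_of_le (mem_Ici.1 hb)]
      exact Icc_subset_Icc ha le_rfl)
  refine ⟨fun t => Matrix.of fun i c => y c (Sum.inl i) t,
    fun t => Matrix.of fun i c => y c (Sum.inr i) t,
    fun a ha b hb hab i c => hac c _ a ha b hb hab, fun a ha b hb hab i c => hac c _ a ha b hb hab,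
    by ext i c; simp [hy0], by ext i c; simp [hy0], ?_⟩
  have hall := ae_all_iff.2 hyd
  filter_upwards [hall] with t ht hmem
  refine ⟨fun i c => ?_, fun i c => ?_⟩
  · have h := ht c hmem (Sum.inl i)
    simp only [Fintype.sum_sum_type, Matrix.fromBlocks_apply₁₁, Matrix.fromBlocks_apply₁₂] at h
    refine h.congr_deriv ?_
    simp only [Matrix.neg_apply, Matrix.add_apply, Matrix.mul_apply, neg_mul,
      Finset.sum_neg_distrib, Matrix.of_apply]
    ring
  · have h := ht c hmem (Sum.inr i)
    simp only [Fintype.sum_sum_type, Matrix.fromBlocks_apply₂₁, Matrix.fromBlocks_apply₂₂] at h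
    refine h.congr_deriv ?_
    simp [Matrix.mul_apply]

theorem isRiccatiSolutionOn_mul_inv {P Q R S X V : ℝ → Matrix (Fin n) (Fin n) ℂ} {t₀ : ℝ}
    (hX : MatrixAbsolutelyContinuousOn X (Ici t₀)) (hV : MatrixAbsolutelyContinuousOn V (Ici t₀))
    (hd : ∀ᵐ t, t₀ ≤ t → HasMatrixDerivAt X (-(Q t * X t + S t * V t)) t ∧
      HasMatrixDerivAt V (P t * X t + R t * V t) t)
    (hdet : ∀ t, t₀ ≤ t → (V t).det ≠ 0) :
    IsRiccatiSolutionOn P Q R S (Ici t₀) (fun t => X t * (V t)⁻¹) := by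
  refine ⟨hX.mul (hV.inv ordConnected_Ici hdet), ?_⟩
  filter_upwards [hd, hV.ae_hasMatrixDerivAt_inv hdet] with t h1 h2 ht
  have ht' : t₀ ≤ t := ht
  have hV1 : V t * (V t)⁻¹ = 1 := Matrix.mul_nonsing_inv _ (isUnit_iff_ne_zero.2 (hdet t ht'))
  have h3 := h2 ht'
  rw [(h1 ht').2.matrixDeriv_eq] at h3
  rw [((h1 ht').1.mul h3).matrixDeriv_eq]
  have e1 : -(Q t * X t + S t * V t) * (V t)⁻¹ = -(Q t * X t * (V t)⁻¹ + S t) := by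
    rw [neg_mul, add_mul, mul_assoc (S t), hV1, mul_one]
  have e2 : X t * -((V t)⁻¹ * (P t * X t + R t * V t) * (V t)⁻¹) =
      -(X t * (V t)⁻¹ * P t * (X t * (V t)⁻¹) + X t * (V t)⁻¹ * R t) := by
    have : (P t * X t + R t * V t) * (V t)⁻¹ = P t * (X t * (V t)⁻¹) + R t := by
      rw [add_mul, mul_assoc (R t), hV1, mul_one, mul_assoc]
    rw [mul_assoc (V t)⁻¹, this]
    noncomm_ring
  rw [e1, e2]
  noncomm_ring

/-! ### The Hermitian form carried by the linearization -/

/-- The Hermitian form `V* W + W* V` with `W = U⁻¹ X - Λ V`, for a solution `(X, V)` of the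
linearization. Where `V` is invertible and `Z = X V⁻¹`, it is `V*` times the gap of `Z` times
`V`. -/
noncomputable def linearizationForm (U L X V : Matrix (Fin n) (Fin n) ℂ) :
    Matrix (Fin n) (Fin n) ℂ :=
  Vᴴ * (U⁻¹ * X - L * V) + (U⁻¹ * X - L * V)ᴴ * V

theorem linearizationForm_isHermitian (U L X V : Matrix (Fin n) (Fin n) ℂ) :
    (linearizationForm U L X V).IsHermitian := by
  simp [Matrix.IsHermitian, linearizationForm, Matrix.conjTranspose_mul, add_comm]

theorem linearizationForm_mul_one (U L Z : Matrix (Fin n) (Fin n) ℂ) :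
    linearizationForm U L Z 1 = riccatiGap U L Z := by
  simp only [linearizationForm, riccatiGap, Matrix.conjTranspose_sub, Matrix.conjTranspose_mul,
    Matrix.conjTranspose_nonsing_inv, Matrix.conjTranspose_one]
  noncomm_ring

theorem riccatiGap_mul_inv {U L X V : Matrix (Fin n) (Fin n) ℂ} (hV : V.det ≠ 0) :
    riccatiGap U L (X * V⁻¹) = (V⁻¹)ᴴ * linearizationForm U L X V * V⁻¹ := by
  have h1 : V * V⁻¹ = 1 := Matrix.mul_nonsing_inv _ (isUnit_iff_ne_zero.2 hV)
  have h2 : (V⁻¹)ᴴ * Vᴴ = 1 := by rw [← Matrix.conjTranspose_mul, h1, Matrix.conjTranspose_one]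
  rw [← linearizationForm_mul_one]
  have e : (U⁻¹ * X - L * V) * V⁻¹ = U⁻¹ * (X * V⁻¹) - L * 1 := by
    rw [sub_mul, mul_assoc, mul_assoc, h1]
  have e' : (V⁻¹)ᴴ * (U⁻¹ * X - L * V)ᴴ = (U⁻¹ * (X * V⁻¹) - L * 1)ᴴ := by
    rw [← e, Matrix.conjTranspose_mul]
  simp only [linearizationForm]
  rw [← e', ← e, mul_add, add_mul, ← mul_assoc _ Vᴴ, h2, mul_assoc _ _ V⁻¹, mul_assoc _ _ V⁻¹,
    mul_assoc _ V, h1]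
  simp

/-- The derivative of `V* W + W* V` when `W' = -(B + Λ A) W - T V` and
`V' = A W + (B* + A Λ* + μ) V` with `A` Hermitian: the terms with `B` and `Λ` cancel. -/
theorem form_derivative_identity {A B L T V W : Matrix (Fin n) (Fin n) ℂ} (hA : A.IsHermitian)
    (μ : ℝ) {V' W' : Matrix (Fin n) (Fin n) ℂ}
    (hV' : V' = A * W + (Bᴴ + A * Lᴴ) * V + (μ : ℂ) • V)
    (hW' : W' = -((B + L * A) * W) - T * V) :
    (V'ᴴ * W + Vᴴ * W') + (W'ᴴ * V + Wᴴ * V') =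
      (μ : ℂ) • (Vᴴ * W + Wᴴ * V) + ((2 : ℝ) • (Wᴴ * A * W) + Vᴴ * (-(T + Tᴴ)) * V) := by
  have hA' : Aᴴ = A := hA
  subst hV' hW'
  simp only [Matrix.conjTranspose_add, Matrix.conjTranspose_sub, Matrix.conjTranspose_neg,
    Matrix.conjTranspose_mul, Matrix.conjTranspose_smul, Matrix.conjTranspose_conjTranspose, hA',
    Complex.star_def, Complex.conj_ofReal, add_mul, mul_add, smul_mul_assoc, mul_smul_comm,
    smul_add, two_smul]
  noncomm_ring

/-- The equation of `V`, written in terms of `W = U⁻¹ X - Λ V`. -/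
theorem linearization_deriv_eq {P R U L X V : Matrix (Fin n) (Fin n) ℂ} (hU : U.det ≠ 0) :
    P * X + R * V = P * U * (U⁻¹ * X - L * V) + (P * U * L + R) * V := by
  have hX : X = U * (U⁻¹ * X) := by
    rw [← mul_assoc, Matrix.mul_nonsing_inv _ (isUnit_iff_ne_zero.2 hU), one_mul]
  conv_lhs => rw [hX]
  noncomm_ring

/-- The equation of `W = U⁻¹ X - Λ V`, with `W` itself in place of `X`. -/
theorem linearization_sub_deriv_eq {P Q R S U U' L L' X V : Matrix (Fin n) (Fin n) ℂ}
    (hU : U.det ≠ 0) :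
    -(U⁻¹ * U' * U⁻¹) * X + U⁻¹ * -(Q * X + S * V) - (L' * V + L * (P * X + R * V)) =
      -((U⁻¹ * U' + U⁻¹ * Q * U + L * (P * U)) * (U⁻¹ * X - L * V))
        - (L' + L * P * U * L + (U⁻¹ * U' + U⁻¹ * Q * U) * L + L * R + U⁻¹ * S) * V := by
  have hX : X = U * (U⁻¹ * X) := by
    rw [← mul_assoc, Matrix.mul_nonsing_inv _ (isUnit_iff_ne_zero.2 hU), one_mul]
  have e : -(U⁻¹ * U' * U⁻¹) * X = -(U⁻¹ * U' * (U⁻¹ * X)) := by noncomm_ring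
  rw [e]
  set x := U⁻¹ * X
  rw [hX]
  noncomm_ring

theorem dotProduct_conjTranspose_mul_mul (A W : Matrix (Fin n) (Fin n) ℂ) (ξ : Fin n → ℂ) :
    star ξ ⬝ᵥ (Wᴴ * A * W) *ᵥ ξ = star (W *ᵥ ξ) ⬝ᵥ A *ᵥ (W *ᵥ ξ) := by
  rw [Matrix.star_mulVec, ← Matrix.dotProduct_mulVec, Matrix.mulVec_mulVec, Matrix.mulVec_mulVec,
    mul_assoc]

theorem Matrix.IsHermitian.posSemidef_of_re_nonneg {N : Matrix (Fin n) (Fin n) ℂ}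
    (hN : N.IsHermitian) (h : ∀ ξ, 0 ≤ (star ξ ⬝ᵥ N *ᵥ ξ).re) : N.PosSemidef :=
  .of_dotProduct_mulVec_nonneg hN fun ξ =>
    Complex.nonneg_iff.2 ⟨h ξ, (hN.im_star_dotProduct_mulVec_self ξ).symm⟩

theorem Matrix.IsHermitian.posDef_of_re_pos {N : Matrix (Fin n) (Fin n) ℂ}
    (hN : N.IsHermitian) (h : ∀ ξ, ξ ≠ 0 → 0 < (star ξ ⬝ᵥ N *ᵥ ξ).re) : N.PosDef :=
  .of_dotProduct_mulVec_pos hN fun ξ hξ =>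
    Complex.pos_iff.2 ⟨h ξ hξ, (hN.im_star_dotProduct_mulVec_self ξ).symm⟩

theorem linearizationForm_re_eq_zero {U L X V : Matrix (Fin n) (Fin n) ℂ} {ξ : Fin n → ℂ}
    (h : V *ᵥ ξ = 0) : (star ξ ⬝ᵥ linearizationForm U L X V *ᵥ ξ).re = 0 := by
  rw [linearizationForm, Matrix.add_mulVec, dotProduct_add, ← Matrix.mulVec_mulVec,
    ← Matrix.mulVec_mulVec, h, Matrix.dotProduct_mulVec, ← Matrix.star_mulVec, h]
  simp

/-- If a Hermitian form satisfies `N' = μ N + D` with `D ≥ 0`, then each of its values grows at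
least as fast as `exp (∫ μ)`. -/
theorem exp_integral_mul_form_le {N D : ℝ → Matrix (Fin n) (Fin n) ℂ} {μ : ℝ → ℝ} {t₀ a b : ℝ}
    (ha : t₀ ≤ a) (hab : a ≤ b) (hN : MatrixAbsolutelyContinuousOn N (Ici t₀))
    (hμ : IntervalIntegrable μ volume a b)
    (hd : ∀ᵐ t, t₀ ≤ t → HasMatrixDerivAt N ((μ t : ℂ) • N t + D t) t)
    (hD : ∀ᵐ t, t₀ ≤ t → (D t).PosSemidef) (ξ : Fin n → ℂ) :
    Real.exp (∫ s in a..b, μ s) * (star ξ ⬝ᵥ N a *ᵥ ξ).re ≤ (star ξ ⬝ᵥ N b *ᵥ ξ).re := by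
  refine (hN.dotProduct_mulVec ha (ha.trans hab) hab ξ).exp_integral_mul_le hab hμ ?_
  filter_upwards [hd, hD] with t h1 h2 ht
  have ht0 : t₀ ≤ t := ha.trans ht.1
  rw [((h1 ht0).dotProduct_mulVec ξ).deriv, Matrix.add_mulVec, dotProduct_add, Complex.add_re,
    Matrix.smul_mulVec, dotProduct_smul, smul_eq_mul, Complex.re_ofReal_mul]
  exact le_add_of_nonneg_right (Complex.nonneg_iff.1 ((h2 ht0).dotProduct_mulVec_nonneg ξ)).1

theorem MatrixAbsolutelyContinuousOn.linearizationForm {U L X V : ℝ → Matrix (Fin n) (Fin n) ℂ}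
    {t₀ : ℝ} (hU : MatrixAbsolutelyContinuousOn U (Ici t₀))
    (hUdet : ∀ t, t₀ ≤ t → (U t).det ≠ 0) (hL : MatrixAbsolutelyContinuousOn L (Ici t₀))
    (hX : MatrixAbsolutelyContinuousOn X (Ici t₀))
    (hV : MatrixAbsolutelyContinuousOn V (Ici t₀)) :
    MatrixAbsolutelyContinuousOn
      (fun t => _root_.linearizationForm (U t) (L t) (X t) (V t)) (Ici t₀) := by
  have hW := ((hU.inv ordConnected_Ici hUdet).mul hX).sub (hL.mul hV)
  exact (hV.conjTranspose.mul hW).add (hW.conjTranspose.mul hV)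

/-- The growth term `2 W* P U W - V* (T + T*) V` in the derivative of the form `V* W + W* V`, where
`W = U⁻¹ X - Λ V`; it is used with `T = S_{U,Λ}(t)`. -/
noncomputable def formGrowth (P U L X V T : Matrix (Fin n) (Fin n) ℂ) :
    Matrix (Fin n) (Fin n) ℂ :=
  (2 : ℝ) • ((U⁻¹ * X - L * V)ᴴ * (P * U) * (U⁻¹ * X - L * V)) + Vᴴ * (-(T + Tᴴ)) * V

theorem formGrowth_posSemidef {P U T : Matrix (Fin n) (Fin n) ℂ} (hPU : (P * U).PosSemidef)
    (hT : (-(T + Tᴴ)).PosSemidef) (L X V : Matrix (Fin n) (Fin n) ℂ) :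
    (formGrowth P U L X V T).PosSemidef :=
  ((hPU.conjTranspose_mul_mul_same _).smul zero_le_two).add (hT.conjTranspose_mul_mul_same _)

/-- A null vector `ξ` of the growth satisfies `P U W ξ = 0`. -/
theorem mulVec_eq_zero_of_formGrowth {P U T L X V : Matrix (Fin n) (Fin n) ℂ} {ξ : Fin n → ℂ}
    (hPU : (P * U).PosSemidef) (hT : (-(T + Tᴴ)).PosSemidef)
    (h : (star ξ ⬝ᵥ formGrowth P U L X V T *ᵥ ξ).re = 0) :
    (P * U * (U⁻¹ * X - L * V)) *ᵥ ξ = 0 := by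
  have h1 := Complex.nonneg_iff.1 (hPU.dotProduct_mulVec_nonneg ((U⁻¹ * X - L * V) *ᵥ ξ))
  have h2 := Complex.nonneg_iff.1 (hT.dotProduct_mulVec_nonneg (V *ᵥ ξ))
  rw [formGrowth, Matrix.add_mulVec, dotProduct_add, Matrix.smul_mulVec, dotProduct_smul,
    dotProduct_conjTranspose_mul_mul, dotProduct_conjTranspose_mul_mul, Complex.add_re,
    Complex.smul_re, smul_eq_mul] at h
  rw [← Matrix.mulVec_mulVec]
  refine (hPU.dotProduct_mulVec_zero_iff _).1 (Complex.ext ?_ h1.2.symm)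
  rw [Complex.zero_re]
  linarith [h1.1, h2.1]

section Persistence

variable {t₀ : ℝ} {P Q R S U L X V : ℝ → Matrix (Fin n) (Fin n) ℂ} {mu : ℝ → ℝ}

/-- The form of a solution of the linearization satisfies `N' = μ N + D` with `D ≥ 0`: this is
where the shape of `R` enters. -/
theorem ae_hasMatrixDerivAt_linearizationForm
    (hU : MatrixAbsolutelyContinuousOn U (Ici t₀)) (hUdet : ∀ t, t₀ ≤ t → (U t).det ≠ 0)
    (hL : MatrixAbsolutelyContinuousOn L (Ici t₀))
    (hI : ∀ᵐ t, t₀ ≤ t → (P t * U t).PosSemidef)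
    (hII : ∀ᵐ t, t₀ ≤ t →
      R t = ((U t)⁻¹ * Q t * U t)ᴴ + P t * U t * ((L t)ᴴ - L t)
        + ((U t)⁻¹ * matrixDeriv U t)ᴴ + ((mu t : ℝ) : ℂ) • (1 : Matrix (Fin n) (Fin n) ℂ))
    (hd : ∀ᵐ t, t₀ ≤ t → HasMatrixDerivAt X (-(Q t * X t + S t * V t)) t ∧
      HasMatrixDerivAt V (P t * X t + R t * V t) t) :
    ∀ᵐ t, t₀ ≤ t → HasMatrixDerivAt (fun t => linearizationForm (U t) (L t) (X t) (V t))
      ((mu t : ℂ) • linearizationForm (U t) (L t) (X t) (V t) +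
        formGrowth (P t) (U t) (L t) (X t) (V t) (riccatiS P Q R S U L t)) t := by
  filter_upwards [hI, hII, hd, hU.ae_hasMatrixDerivAt_inv hUdet, hL.ae_hasMatrixDerivAt]
    with t h1 h2 h3 h4 h5 ht
  have hW := ((h4 ht).mul (h3 ht).1).sub ((h5 ht).mul (h3 ht).2)
  have hV := (h3 ht).2
  have e : (mu t : ℂ) • V t = ((mu t : ℂ) • (1 : Matrix (Fin n) (Fin n) ℂ)) * V t := by
    rw [smul_mul_assoc, one_mul]
  have hN := (hV.conjTranspose.mul hW).add (hW.conjTranspose.mul hV)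
  have key := form_derivative_identity (A := P t * U t)
    (B := (U t)⁻¹ * matrixDeriv U t + (U t)⁻¹ * Q t * U t) (L := L t)
    (T := riccatiS P Q R S U L t) (h1 ht).isHermitian (mu t) (V' := P t * X t + R t * V t)
    ((linearization_deriv_eq (L := L t) (hUdet t ht)).trans (by
      rw [h2 ht, Matrix.conjTranspose_add, e, add_assoc (P t * U t * _), ← add_mul]
      congr 2
      noncomm_ring)) (linearization_sub_deriv_eq (hUdet t ht))
  rw [key] at hN
  exact hN

/-- `V` stays invertible. If `V(t₁) ξ = 0`, the value of the form at `ξ` vanishes at `t₁`, hence on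
`[t₀, t₁]` by monotonicity; then so does its growth, `P U W ξ = 0`, and `V ξ` solves a
homogeneous linear equation on `[t₀, t₁]`, so `ξ = V(t₀) ξ = 0`. -/
theorem det_ne_zero_of_linearizationForm_posSemidef
    (hP : MatrixLocallyIntegrableOn P (Ici t₀)) (hR : MatrixLocallyIntegrableOn R (Ici t₀))
    (hU : MatrixAbsolutelyContinuousOn U (Ici t₀)) (hUdet : ∀ t, t₀ ≤ t → (U t).det ≠ 0)
    (hL : MatrixAbsolutelyContinuousOn L (Ici t₀))
    (hmu : LocallyIntegrableOn mu (Ici t₀) volume)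
    (hI : ∀ᵐ t, t₀ ≤ t → (P t * U t).PosSemidef)
    (hIII : ∀ᵐ t, t₀ ≤ t →
      (-(riccatiS P Q R S U L t + (riccatiS P Q R S U L t)ᴴ)).PosSemidef)
    (hX : MatrixAbsolutelyContinuousOn X (Ici t₀)) (hV : MatrixAbsolutelyContinuousOn V (Ici t₀))
    (hV0 : V t₀ = 1)
    (hd : ∀ᵐ t, t₀ ≤ t → HasMatrixDerivAt V (P t * X t + R t * V t) t)
    (hN : ∀ᵐ t, t₀ ≤ t → HasMatrixDerivAt (fun t => linearizationForm (U t) (L t) (X t) (V t))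
      ((mu t : ℂ) • linearizationForm (U t) (L t) (X t) (V t) +
        formGrowth (P t) (U t) (L t) (X t) (V t) (riccatiS P Q R S U L t)) t)
    (h0 : (linearizationForm (U t₀) (L t₀) (X t₀) (V t₀)).PosSemidef) :
    ∀ t, t₀ ≤ t → (V t).det ≠ 0 := by
  intro b hb hdet
  obtain ⟨ξ, hξ, hVξ⟩ := Matrix.exists_mulVec_eq_zero_iff.2 hdet
  have hNac := hU.linearizationForm hUdet hL hX hV
  have hD : ∀ᵐ t, t₀ ≤ t →
      (formGrowth (P t) (U t) (L t) (X t) (V t) (riccatiS P Q R S U L t)).PosSemidef := by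
    filter_upwards [hI, hIII] with t h1 h2 ht
    exact formGrowth_posSemidef (h1 ht) (h2 ht) _ _ _
  have hmuab : ∀ a c, t₀ ≤ a → a ≤ c → IntervalIntegrable mu volume a c := fun a c ha hac =>
    (intervalIntegrable_iff_integrableOn_Icc_of_le hac).2
      (hmu.integrableOn_compact_subset (fun x hx => ha.trans hx.1) isCompact_Icc)
  set q : ℝ → ℝ := fun t =>
    (star ξ ⬝ᵥ linearizationForm (U t) (L t) (X t) (V t) *ᵥ ξ).re with hq
  have hq0 : 0 ≤ q t₀ := (Complex.nonneg_iff.1 (h0.dotProduct_mulVec_nonneg ξ)).1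
  have hqb : q b = 0 := linearizationForm_re_eq_zero hVξ
  have hqz : ∀ t ∈ Icc t₀ b, q t = 0 := by
    intro t ht
    have h1 := exp_integral_mul_form_le le_rfl ht.1 hNac (hmuab _ _ le_rfl ht.1) hN hD ξ
    have h2 := exp_integral_mul_form_le ht.1 ht.2 hNac (hmuab _ _ ht.1 ht.2) hN hD ξ
    refine le_antisymm ?_ ((mul_nonneg (Real.exp_pos _).le hq0).trans h1)
    exact nonpos_of_mul_nonpos_right (h2.trans_eq hqb) (Real.exp_pos _)
  have hne0 : ∀ᵐ t : ℝ, t ≠ t₀ := by simp [ae_iff, measure_singleton]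
  have hneb : ∀ᵐ t : ℝ, t ≠ b := by simp [ae_iff, measure_singleton]
  -- The vector function `V ξ` is encoded as the matrix function with all columns equal to it.
  set Ξ : Matrix (Fin n) (Fin n) ℂ := Matrix.of fun i _ => ξ i with hΞ
  have hmulΞ : ∀ (M : Matrix (Fin n) (Fin n) ℂ), M *ᵥ ξ = 0 → M * Ξ = 0 := by
    intro M hM
    ext i j
    exact congrFun hM i
  have hcoef : MatrixIntervalIntegrable (fun t => -(P t * U t * L t + R t)) t₀ b :=
    ((((hP.matrixIntervalIntegrable le_rfl hb).mul_continuousOn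
      ((hU.mono Icc_subset_Ici_self).continuousOn_Icc hb)).mul_continuousOn
      ((hL.mono Icc_subset_Ici_self).continuousOn_Icc hb)).add
      (hR.matrixIntervalIntegrable le_rfl hb)).neg
  have hzero := eq_zero_of_hasMatrixDerivAt_two_sided
    ((hV.mul (.const Ξ _)).mono Icc_subset_Ici_self) hcoef (.zero t₀ b) (by
      filter_upwards [hd, hN, hI, hIII, hne0, hneb] with t h1 h2 h3 h4 h5 h6 ht
      have hlt : t ∈ Ioo t₀ b := ⟨lt_of_le_of_ne ht.1 h5.symm, lt_of_le_of_ne ht.2 h6⟩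
      have hder : (star ξ ⬝ᵥ ((mu t : ℂ) • linearizationForm (U t) (L t) (X t) (V t) +
          formGrowth (P t) (U t) (L t) (X t) (V t) (riccatiS P Q R S U L t)) *ᵥ ξ).re = 0 := by
        refine ((h2 ht.1).dotProduct_mulVec ξ).unique
          ((hasDerivAt_const t (0 : ℝ)).congr_of_eventuallyEq ?_)
        filter_upwards [Ioo_mem_nhds hlt.1 hlt.2] with s hs
        exact hqz s (Ioo_subset_Icc_self hs)
      rw [Matrix.add_mulVec, dotProduct_add, Complex.add_re, Matrix.smul_mulVec, dotProduct_smul,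
        smul_eq_mul, Complex.re_ofReal_mul] at hder
      have hqt : (star ξ ⬝ᵥ linearizationForm (U t) (L t) (X t) (V t) *ᵥ ξ).re = 0 := hqz t ht
      rw [hqt, mul_zero, zero_add] at hder
      have hPW := hmulΞ _ (mulVec_eq_zero_of_formGrowth (h3 ht.1) (h4 ht.1) hder)
      rw [((h1 ht.1).mul (.const Ξ t)).matrixDeriv_eq,
        linearization_deriv_eq (P := P t) (R := R t) (L := L t) (X := X t) (V := V t)
          (hUdet t ht.1), add_mul, hPW]
      noncomm_ring)
    (right_mem_Icc.2 hb) (hmulΞ _ hVξ) t₀ (left_mem_Icc.2 hb)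
  rw [hV0, one_mul] at hzero
  exact hξ (funext fun i => congrFun (congrFun hzero i) i)

/-- Global existence, uniqueness and persistence of the gap inequality, for a gap that is
initially only positive semidefinite. -/
theorem exists_riccati_solution_gap
    (hP : MatrixLocallyIntegrableOn P (Ici t₀)) (hQ : MatrixLocallyIntegrableOn Q (Ici t₀))
    (hR : MatrixLocallyIntegrableOn R (Ici t₀)) (hS : MatrixLocallyIntegrableOn S (Ici t₀))
    (hU : MatrixAbsolutelyContinuousOn U (Ici t₀)) (hUdet : ∀ t, t₀ ≤ t → (U t).det ≠ 0)
    (hL : MatrixAbsolutelyContinuousOn L (Ici t₀))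
    (hmu : LocallyIntegrableOn mu (Ici t₀) volume)
    (hI : ∀ᵐ t, t₀ ≤ t → (P t * U t).PosSemidef)
    (hII : ∀ᵐ t, t₀ ≤ t →
      R t = ((U t)⁻¹ * Q t * U t)ᴴ + P t * U t * ((L t)ᴴ - L t)
        + ((U t)⁻¹ * matrixDeriv U t)ᴴ + ((mu t : ℝ) : ℂ) • (1 : Matrix (Fin n) (Fin n) ℂ))
    (hIII : ∀ᵐ t, t₀ ≤ t →
      (-(riccatiS P Q R S U L t + (riccatiS P Q R S U L t)ᴴ)).PosSemidef)
    (Z₀ : Matrix (Fin n) (Fin n) ℂ) (hZ₀ : (riccatiGap (U t₀) (L t₀) Z₀).PosSemidef) :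
    ∃ Z : ℝ → Matrix (Fin n) (Fin n) ℂ,
      IsRiccatiSolutionOn P Q R S (Ici t₀) Z ∧ Z t₀ = Z₀ ∧
      (∀ I : Set ℝ, I.OrdConnected → t₀ ∈ I → I ⊆ Ici t₀ →
        ∀ Y : ℝ → Matrix (Fin n) (Fin n) ℂ,
          IsRiccatiSolutionOn P Q R S I Y → Y t₀ = Z₀ → EqOn Y Z I) ∧
      ∀ t, t₀ ≤ t → (riccatiGap (U t) (L t) (Z t)).PosSemidef ∧
        ((riccatiGap (U t₀) (L t₀) Z₀).PosDef → (riccatiGap (U t) (L t) (Z t)).PosDef) := by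
  obtain ⟨X, V, hX, hV, hX0, hV0, hd⟩ := exists_riccati_linearization hP hQ hR hS Z₀
  have hN := ae_hasMatrixDerivAt_linearizationForm hU hUdet hL hI hII hd
  have h0 : linearizationForm (U t₀) (L t₀) (X t₀) (V t₀) = riccatiGap (U t₀) (L t₀) Z₀ := by
    rw [hX0, hV0, linearizationForm_mul_one]
  have hdet := det_ne_zero_of_linearizationForm_posSemidef hP hR hU hUdet hL hmu hI hIII hX hV hV0
    (hd.mono fun t h ht => (h ht).2) hN (h0 ▸ hZ₀)
  have hsol := isRiccatiSolutionOn_mul_inv hX hV hd hdet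
  refine ⟨_, hsol, by simp [hX0, hV0], ?_, fun t ht => ?_⟩
  · intro I hIc ht0 hIsub Y hY hY0 t ht
    have ht' : t₀ ≤ t := hIsub ht
    have hsub : Icc t₀ t ⊆ I := hIc.out ht0 ht
    exact IsRiccatiSolutionOn.eq_of_eq_left ht' (hP.matrixIntervalIntegrable le_rfl ht')
      (hQ.matrixIntervalIntegrable le_rfl ht') (hR.matrixIntervalIntegrable le_rfl ht')
      ⟨hY.1.mono hsub, hY.2.mono fun s hs hmem => hs (hsub hmem)⟩
      ⟨hsol.1.mono (hsub.trans hIsub), hsol.2.mono fun s hs hmem => hs (hIsub (hsub hmem))⟩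
      (by simp [hX0, hV0, hY0])
  · have hD : ∀ᵐ t, t₀ ≤ t →
        (formGrowth (P t) (U t) (L t) (X t) (V t) (riccatiS P Q R S U L t)).PosSemidef := by
      filter_upwards [hI, hIII] with t h1 h2 ht
      exact formGrowth_posSemidef (h1 ht) (h2 ht) _ _ _
    have hgrow := fun ξ => exp_integral_mul_form_le le_rfl ht (hU.linearizationForm hUdet hL hX hV)
      ((intervalIntegrable_iff_integrableOn_Icc_of_le ht).2
        (hmu.integrableOn_compact_subset (fun x hx => hx.1) isCompact_Icc)) hN hD ξ
    simp only [h0] at hgrow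
    have hherm := linearizationForm_isHermitian (U t) (L t) (X t) (V t)
    rw [riccatiGap_mul_inv (hdet t ht)]
    refine ⟨(hherm.posSemidef_of_re_nonneg fun ξ => ?_).conjTranspose_mul_mul_same _, fun hpos =>
      (hherm.posDef_of_re_pos fun ξ hξ => ?_).conjTranspose_mul_mul_same ?_⟩
    · exact (mul_nonneg (Real.exp_pos _).le
        (Complex.nonneg_iff.1 (hZ₀.dotProduct_mulVec_nonneg ξ)).1).trans (hgrow ξ)
    · exact (mul_pos (Real.exp_pos _)
        (Complex.pos_iff.1 (hpos.dotProduct_mulVec_pos hξ)).1).trans_le (hgrow ξ)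
    · exact Matrix.mulVec_injective_of_isUnit
        ((Matrix.isUnit_nonsing_inv_iff).2
          ((Matrix.isUnit_iff_isUnit_det _).2 (isUnit_iff_ne_zero.2 (hdet t ht))))

end Persistence

end MatrixFunctions

theorem theorem3p1 (n : ℕ) (t₀ : ℝ)
    (P Q R S : ℝ → Matrix (Fin n) (Fin n) ℂ)
    (hP : MatrixLocallyIntegrableOn P (Ici t₀))
    (hQ : MatrixLocallyIntegrableOn Q (Ici t₀))
    (hR : MatrixLocallyIntegrableOn R (Ici t₀))
    (hS : MatrixLocallyIntegrableOn S (Ici t₀))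
    (U L : ℝ → Matrix (Fin n) (Fin n) ℂ) (mu : ℝ → ℝ)
    (hU : MatrixAbsolutelyContinuousOn U (Ici t₀))
    (hUdet : ∀ t, t₀ ≤ t → (U t).det ≠ 0)
    (hL : MatrixAbsolutelyContinuousOn L (Ici t₀))
    (hmu : LocallyIntegrableOn mu (Ici t₀) volume)
    -- Condition I (`Matrix.PosSemidef` includes being Hermitian)
    (hI : ∀ᵐ t, t₀ ≤ t → (P t * U t).PosSemidef)
    -- Condition II
    (hII : ∀ᵐ t, t₀ ≤ t →
      R t = ((U t)⁻¹ * Q t * U t)ᴴ + P t * U t * ((L t)ᴴ - L t)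
        + ((U t)⁻¹ * matrixDeriv U t)ᴴ + ((mu t : ℝ) : ℂ) • (1 : Matrix (Fin n) (Fin n) ℂ))
    -- Condition III
    (hIII : ∀ᵐ t, t₀ ≤ t →
      (-(riccatiS P Q R S U L t + (riccatiS P Q R S U L t)ᴴ)).PosSemidef) :
    -- strict inequality: the solution with initial value `Z₀` exists on `[t₀, ∞)`, every
    -- solution with this initial value on a subinterval is its restriction, and the
    -- inequality persists
    (∀ Z₀ : Matrix (Fin n) (Fin n) ℂ, (riccatiGap (U t₀) (L t₀) Z₀).PosDef →
      ∃ Z : ℝ → Matrix (Fin n) (Fin n) ℂ,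
        IsRiccatiSolutionOn P Q R S (Ici t₀) Z ∧ Z t₀ = Z₀ ∧
        (∀ I : Set ℝ, I.OrdConnected → t₀ ∈ I → I ⊆ Ici t₀ →
          ∀ Y : ℝ → Matrix (Fin n) (Fin n) ℂ,
            IsRiccatiSolutionOn P Q R S I Y → Y t₀ = Z₀ → EqOn Y Z I) ∧
        ∀ t, t₀ ≤ t → (riccatiGap (U t) (L t) (Z t)).PosDef) ∧
    -- the same with the non-strict inequality
    (((U t₀)⁻¹ + ((U t₀)⁻¹)ᴴ).PosDef →
      ∀ Z₀ : Matrix (Fin n) (Fin n) ℂ, (riccatiGap (U t₀) (L t₀) Z₀).PosSemidef →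
        ∃ Z : ℝ → Matrix (Fin n) (Fin n) ℂ,
          IsRiccatiSolutionOn P Q R S (Ici t₀) Z ∧ Z t₀ = Z₀ ∧
          (∀ I : Set ℝ, I.OrdConnected → t₀ ∈ I → I ⊆ Ici t₀ →
            ∀ Y : ℝ → Matrix (Fin n) (Fin n) ℂ,
              IsRiccatiSolutionOn P Q R S I Y → Y t₀ = Z₀ → EqOn Y Z I) ∧
          ∀ t, t₀ ≤ t → (riccatiGap (U t) (L t) (Z t)).PosSemidef) := by
  have main := exists_riccati_solution_gap hP hQ hR hS hU hUdet hL hmu hI hII hIII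
  refine ⟨fun Z₀ hZ₀ => ?_, fun _ Z₀ hZ₀ => ?_⟩
  · obtain ⟨Z, hsol, hinit, huniq, hgap⟩ := main Z₀ hZ₀.posSemidef
    exact ⟨Z, hsol, hinit, huniq, fun t ht => (hgap t ht).2 hZ₀⟩
  · obtain ⟨Z, hsol, hinit, huniq, hgap⟩ := main Z₀ hZ₀
    exact ⟨Z, hsol, hinit, huniq, fun t ht => (hgap t ht).1⟩
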